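/- A drawing of a finite simple graph $G$ in the plane represents the vertices by distinct points and each edge by a simple arc joining the points of its two end vertices, with no vertex in the relative interior of the arc. The crossings of a drawing are the common points of the relative interiors of two distinct edges, counted once for each such pair of edges, and the crossing number $\mathrm{cr}(G)$ is the minimum number of crossings over all drawings of $G$ in the plane. Let $\kappa(n,e)$ be the minimum of $\mathrm{cr}(G)$ over all simple graphs $G$ with $n$ vertices and $e$ edges. Then $$\kappa(n,e)\,\frac{n^2}{e^3}\;\le\;\frac{8}{9\pi^2}+o(1)\qquad\text{as } n\to\infty,\ \frac en\to\infty,\ e=o(n^2),$$ that is, for every $\varepsilon>0$ there are $C,\delta>0$ such that $\kappa(n,e)\,n^2/e^3\le \frac{8}{9\pi^2}+\varepsilon$ for all $n\ge C$ and $e$ with $e\ge Cn$ and $e\le\delta n^2$. Consequently, the midrange crossing constant $\gamma$, that is, the limit of $\kappa(n,e)\,n^2/e^3$ as $n\to\infty$ under the constraints $e/n\to\infty$ and $e=o(n^2)$ (which is known to exist), satisfies $\gamma\le \frac{8}{9\pi^2}$. -/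

import Mathlib

open Filter Topology
open scoped NNReal ENNReal

/-- A drawing of a simple graph in the Euclidean plane. Vertices are sent to distinct points; an edge
is sent to a simple arc (an injective continuous image of `[0,1]`) that joins the images of its two
end vertices and has no vertex in its relative interior. -/
structure PlaneDrawing {V : Type*} (G : SimpleGraph V) where
  /-- the point representing a vertex -/
  point : V → EuclideanSpace ℝ (Fin 2)
  /-- a parametrization of the arc representing an edge -/
  arc : G.edgeSet → unitInterval → EuclideanSpace ℝ (Fin 2)
  point_injective : Function.Injective point
  arc_continuous : ∀ a, Continuous (arc a)
  arc_injective : ∀ a, Function.Injective (arc a)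
  arc_ends : ∀ a : G.edgeSet, s(arc a 0, arc a 1) = Sym2.map point (a : Sym2 V)
  arc_avoids : ∀ a t v, arc a t = point v → t = 0 ∨ t = 1

namespace PlaneDrawing

/-- The relative interior of the arc representing the edge `a`. -/
def openArc {V : Type*} {G : SimpleGraph V} (D : PlaneDrawing G) (a : G.edgeSet) :
    Set (EuclideanSpace ℝ (Fin 2)) :=
  D.arc a '' Set.Ioo 0 1

/-- The number of crossings of a drawing: the number of pairs consisting of an unordered pair of
distinct edges and a common point of the relative interiors of their arcs. So a point where `k` arcs
meet is counted `k.choose 2` times, a tangential contact is counted too, and the value is `⊤` if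
there are infinitely many such pairs. -/
noncomputable def crossings {V : Type*} {G : SimpleGraph V} (D : PlaneDrawing G) : ℕ∞ :=
  Set.encard {x : Sym2 G.edgeSet × EuclideanSpace ℝ (Fin 2) |
    ∃ a b : G.edgeSet, a ≠ b ∧ x.1 = s(a, b) ∧ x.2 ∈ D.openArc a ∧ x.2 ∈ D.openArc b}

end PlaneDrawing

/-- The crossing number of a graph: the least number of crossings in a drawing in the plane. -/
noncomputable def crossingNumber {V : Type*} (G : SimpleGraph V) : ℕ∞ :=
  ⨅ D : PlaneDrawing G, D.crossings

/-- The least crossing number of a simple graph with `n` vertices and `e` edges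
(`⊤` if there is no such graph, that is, if `n.choose 2 < e`). -/
noncomputable def minCrossingNumber (n e : ℕ) : ℕ∞ :=
  ⨅ (G : SimpleGraph (Fin n)) (_ : G.edgeSet.ncard = e), crossingNumber G

/-- The quantity `κ(n,e) n² / e³`, for `p = (n, e)`. -/
noncomputable def crossingRatio (p : ℕ × ℕ) : ℝ≥0∞ :=
  (minCrossingNumber p.1 p.2 : ℝ≥0∞) * (p.1 : ℝ≥0∞) ^ 2 / (p.2 : ℝ≥0∞) ^ 3

/-- The midrange regime for pairs `(n, e)`: `n → ∞`, `e / n → ∞` and `e = o(n²)`. -/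
noncomputable def midrange : Filter (ℕ × ℕ) :=
  comap (fun p : ℕ × ℕ => p.1) atTop ⊓
    comap (fun p : ℕ × ℕ => (p.2 : ℝ) / (p.1 : ℝ)) atTop ⊓
    comap (fun p : ℕ × ℕ => (p.2 : ℝ) / (p.1 : ℝ) ^ 2) (𝓝 0)

/-- `γ` is the midrange crossing constant: the limit of `κ(n,e) n² / e³` in the midrange regime. -/
def IsMidrangeCrossingConstant (γ : ℝ≥0) : Prop :=
  Tendsto crossingRatio midrange (𝓝 (γ : ℝ≥0∞))

/-! Take $n$ disjoint cells of area 1 filling roughly a square, put a random point in each, and join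
by straight segments the points of cells at distance less than $R$. About $\pi R^2n/2$ edges arise,
so $R^2\approx 2e/(\pi n)$ suffices. Fix one end of a segment with direction $v$. A segment with
direction $w$ meets it exactly when its starting point lies in a parallelogram of area $|v\times
w|$, and $\iint_{|v|,|w|\le R}|v\times w|=8\pi R^6/9$ (`volume_shortMeetingSegments_le`). As the
cells are disjoint, the expected number of ordered pairs of oriented edges that meet is at most $n$
times this integral, up to an additive error in $R$. Each crossing is counted 8 times, so some
choice of points has at most about $n\pi R^6/9=\frac{8}{9\pi^2}\,e^3/n^2$ crossings
(`crossingNumber_le_of_cells`). Randomness also yields general position almost surely, which a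
lattice would violate. The edge count is `card_edges_gridGraph_ge`, and the asymptotics are in
`eventually_crossingRatio_le`. -/

/-! ### Segments in the plane and their intersections. -/

/-- The signed area of the parallelogram spanned by two plane vectors. -/
def planeCross (u v : ℂ) : ℝ := u.re * v.im - u.im * v.re

/-- The point dividing the segment from `p` to `q` in the ratio `s : 1 - s`. -/
noncomputable def segPoint (p q : ℂ) (s : ℝ) : ℂ := p + s * (q - p)

@[simp] lemma segPoint_zero (p q : ℂ) : segPoint p q 0 = p := by simp [segPoint]

@[simp] lemma segPoint_one (p q : ℂ) : segPoint p q 1 = q := by simp [segPoint]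

lemma segPoint_symm (p q : ℂ) (s : ℝ) : segPoint p q (1 - s) = segPoint q p s := by
  simp only [segPoint]; push_cast; ring

lemma continuous_segPoint (p q : ℂ) : Continuous (segPoint p q) := by
  unfold segPoint; fun_prop

lemma segPoint_injective {p q : ℂ} (h : p ≠ q) : Function.Injective (segPoint p q) := by
  intro s t hst
  simp only [segPoint, add_right_inj] at hst
  exact_mod_cast mul_right_cancel₀ (sub_ne_zero.2 h.symm) hst

lemma segPoint_eq_iff {a b c d : ℂ} {s t : ℝ} : segPoint a b s = segPoint c d t ↔
    a.re + s * (b.re - a.re) = c.re + t * (d.re - c.re) ∧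
    a.im + s * (b.im - a.im) = c.im + t * (d.im - c.im) := by
  simp [segPoint, Complex.ext_iff]

/-- Two distinct common points would put both segments on one line, but `c` is off the line through
`a` and `b`. -/
lemma segPoint_param_unique {a b c d : ℂ} {s t s' t' : ℝ}
    (h : planeCross (b - a) (c - a) ≠ 0) (h₁ : segPoint a b s = segPoint c d t)
    (h₂ : segPoint a b s' = segPoint c d t') : s = s' := by
  rw [segPoint_eq_iff] at h₁ h₂
  obtain ⟨h₁, h₃⟩ := h₁
  obtain ⟨h₂, h₄⟩ := h₂
  refine sub_eq_zero.1 ((mul_eq_zero.1 ?_).resolve_right h)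
  simp only [planeCross, Complex.sub_re, Complex.sub_im]
  linear_combination (t * (d.re - c.re)) * (h₃ - h₄) - (t * (d.im - c.im)) * (h₁ - h₂) +
    (s - s') * ((b.im - a.im) * h₁ - (b.re - a.re) * h₃)

lemma segPoint_common_endpoint {a b c : ℂ} {s t : ℝ} (h : planeCross (b - a) (c - a) ≠ 0)
    (h₁ : segPoint a b s = segPoint a c t) : s = 0 := by
  rw [segPoint_eq_iff] at h₁
  obtain ⟨h₁, h₃⟩ := h₁
  refine (mul_eq_zero.1 ?_).resolve_right h
  simp only [planeCross, Complex.sub_re, Complex.sub_im]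
  linear_combination (c.im - a.im) * h₁ - (c.re - a.re) * h₃

/-- Distinct points, no three of them on a line. -/
def InGeneralPosition {V : Type*} (x : V → ℂ) : Prop :=
  Function.Injective x ∧
    ∀ i j k, i ≠ j → i ≠ k → j ≠ k → planeCross (x j - x i) (x k - x i) ≠ 0

/-- Pairs of segments with a common point. -/
def meetingSegments : Set ((ℂ × ℂ) × (ℂ × ℂ)) :=
  {q | ∃ s t : unitInterval, segPoint q.1.1 q.1.2 s = segPoint q.2.1 q.2.2 t}

/-! ### Straight-line drawings: crossings against meeting pairs of edges. -/

section StraightLine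

variable {V : Type*} {G : SimpleGraph V} {x : V → ℂ}

/-- The drawing of a graph with straight edges on points in general position. -/
noncomputable def straightLineDrawing (G : SimpleGraph V) (hx : InGeneralPosition x) :
    PlaneDrawing G where
  point v := Complex.orthonormalBasisOneI.repr (x v)
  arc a t := Complex.orthonormalBasisOneI.repr
    (segPoint (x (Quot.out a.1).1) (x (Quot.out a.1).2) t)
  point_injective := Complex.orthonormalBasisOneI.repr.injective.comp hx.1
  arc_continuous a := Complex.orthonormalBasisOneI.repr.continuous.comp
    ((continuous_segPoint _ _).comp continuous_subtype_val)
  arc_injective a := by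
    obtain ⟨a, ha⟩ := a
    refine Complex.orthonormalBasisOneI.repr.injective.comp
      ((segPoint_injective ?_).comp Subtype.val_injective)
    intro h
    have h' := hx.1 h
    have hout : s((Quot.out a).1, (Quot.out a).2) = a := Quot.out_eq a
    rw [← hout, SimpleGraph.mem_edgeSet] at ha
    exact ha.ne h'
  arc_ends a := by
    have hout : s((Quot.out a.1).1, (Quot.out a.1).2) = a.1 := Quot.out_eq a.1
    conv_rhs => rw [← hout]
    simp
  arc_avoids a t v h := by
    obtain ⟨a, ha⟩ := a
    have hout : s((Quot.out a).1, (Quot.out a).2) = a := Quot.out_eq a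
    rw [← hout, SimpleGraph.mem_edgeSet] at ha
    have h := Complex.orthonormalBasisOneI.repr.injective h
    dsimp only at h
    generalize (Quot.out a).1 = i at *
    generalize (Quot.out a).2 = j at *
    have hij : x i ≠ x j := fun h' => ha.ne (hx.1 h')
    by_cases hi : i = v
    · left
      subst hi
      exact Subtype.ext (segPoint_injective hij (h.trans (segPoint_zero _ _).symm))
    by_cases hj : j = v
    · right
      subst hj
      exact Subtype.ext (segPoint_injective hij (h.trans (segPoint_one _ _).symm))
    exfalso
    -- A third vertex on the segment would be collinear with its two ends.
    apply hx.2 i j v ha.ne hi hj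
    rw [← h]
    simp [planeCross, segPoint]
    ring

/-- The drawing orients each edge by an arbitrary `Quot.out`. Since reversal only replaces `s` by `1
- s`, either orientation may be used. -/
lemma mem_openArc_straightLineDrawing (hx : InGeneralPosition x) {a : G.edgeSet} {i j : V}
    (ha : a.1 = s(i, j)) {p : EuclideanSpace ℝ (Fin 2)}
    (hp : p ∈ (straightLineDrawing G hx).openArc a) :
    ∃ s ∈ Set.Ioo (0 : unitInterval) 1,
      p = Complex.orthonormalBasisOneI.repr (segPoint (x i) (x j) s) := by
  obtain ⟨t, ht, rfl⟩ := hp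
  have hout : s((Quot.out a.1).1, (Quot.out a.1).2) = a.1 := Quot.out_eq a.1
  rw [ha, Sym2.eq_iff] at hout
  rcases hout with ⟨h₁, h₂⟩ | ⟨h₁, h₂⟩
  · exact ⟨t, ht, by simp only [straightLineDrawing]; rw [← ha] at h₁ h₂; rw [h₁, h₂]⟩
  · refine ⟨unitInterval.symm t, ⟨?_, ?_⟩, ?_⟩
    · rw [← Subtype.coe_lt_coe]; have := Subtype.coe_lt_coe.2 ht.2
      simp at this ⊢; exact this
    · rw [← Subtype.coe_lt_coe]; have := Subtype.coe_lt_coe.2 ht.1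
      simp at this ⊢; exact this
    · simp only [straightLineDrawing]
      rw [← ha] at h₁ h₂
      rw [h₁, h₂, unitInterval.coe_symm_eq, segPoint_symm]

/-- Ordered pairs of oriented edges with four distinct ends that meet in the straight-line
drawing. -/
def meetingQuadruples (G : SimpleGraph V) (x : V → ℂ) : Set ((V × V) × (V × V)) :=
  {q | G.Adj q.1.1 q.1.2 ∧ G.Adj q.2.1 q.2.2 ∧ q.1.1 ≠ q.2.1 ∧ q.1.1 ≠ q.2.2 ∧ q.1.2 ≠ q.2.1 ∧
    q.1.2 ≠ q.2.2 ∧ ((x q.1.1, x q.1.2), (x q.2.1, x q.2.2)) ∈ meetingSegments}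

/-- The two unordered pairs in a quadruple. -/
def quadruplePair (q : (V × V) × (V × V)) : Sym2 (Sym2 V) :=
  s(s(q.1.1, q.1.2), s(q.2.1, q.2.2))

lemma meetingSegments_flip_left {a b c d : ℂ} (h : ((a, b), (c, d)) ∈ meetingSegments) :
    ((b, a), (c, d)) ∈ meetingSegments := by
  obtain ⟨s, t, h⟩ := h
  exact ⟨unitInterval.symm s, t, by rw [unitInterval.coe_symm_eq, segPoint_symm]; exact h⟩

lemma meetingSegments_swap {a b c d : ℂ} (h : ((a, b), (c, d)) ∈ meetingSegments) :
    ((c, d), (a, b)) ∈ meetingSegments := by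
  obtain ⟨s, t, h⟩ := h
  exact ⟨t, s, h.symm⟩

/-- Reversing either edge and swapping the two edges gives $2\cdot2\cdot2$ quadruples over the same
unordered pair. They are distinct because the four ends are. -/
lemma eight_mul_card_quadruplePair_le [Finite V] (G : SimpleGraph V) (x : V → ℂ) :
    8 * (quadruplePair '' meetingQuadruples G x).encard ≤ (meetingQuadruples G x).encard := by
  classical
  have hfin := Set.toFinite (meetingQuadruples G x)
  obtain ⟨T, hT⟩ := hfin.exists_finset_coe
  rw [← hT, ← Finset.coe_image, Set.encard_coe_eq_coe_finsetCard, Set.encard_coe_eq_coe_finsetCard]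
  have flip : ∀ {i j k l}, ((i, j), (k, l)) ∈ T → ((j, i), (k, l)) ∈ T := by
    intro i j k l h
    rw [← Finset.mem_coe, hT] at h ⊢
    obtain ⟨h1, h2, h3, h4, h5, h6, h7⟩ := h
    exact ⟨h1.symm, h2, h5, h6, h3, h4, meetingSegments_flip_left h7⟩
  have swap : ∀ {i j k l}, ((i, j), (k, l)) ∈ T → ((k, l), (i, j)) ∈ T := by
    intro i j k l h
    rw [← Finset.mem_coe, hT] at h ⊢
    obtain ⟨h1, h2, h3, h4, h5, h6, h7⟩ := h
    exact ⟨h2, h1, h3.symm, h5.symm, h4.symm, h6.symm, meetingSegments_swap h7⟩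
  have key : 8 * (T.image quadruplePair).card ≤ T.card := by
    refine Finset.mul_card_image_le_card T 8 ?_
    intro b hb
    obtain ⟨⟨⟨i, j⟩, k, l⟩, hq, rfl⟩ := Finset.mem_image.1 hb
    have hq' := hq
    rw [← Finset.mem_coe, hT] at hq'
    obtain ⟨h1, h2, h3, h4, h5, h6, -⟩ := hq'
    have h1 := h1.ne
    have h2 := h2.ne
    simp only at h1 h2 h3 h4 h5 h6
    have hsub : ({((i, j), (k, l)), ((j, i), (k, l)), ((i, j), (l, k)), ((j, i), (l, k)),
        ((k, l), (i, j)), ((k, l), (j, i)), ((l, k), (i, j)), ((l, k), (j, i))} :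
        Finset ((V × V) × (V × V))) ⊆
        T.filter (fun q => quadruplePair q = quadruplePair ((i, j), (k, l))) := by
      intro q hq
      simp only [Finset.mem_insert, Finset.mem_singleton] at hq
      rw [Finset.mem_filter]
      rcases hq with rfl | rfl | rfl | rfl | rfl | rfl | rfl | rfl
      · exact ⟨hq, rfl⟩
      · exact ⟨flip hq, by simp [quadruplePair, Sym2.eq_swap (a := j)]⟩
      · exact ⟨swap (flip (swap hq)), by simp [quadruplePair, Sym2.eq_swap (a := l)]⟩
      · exact ⟨flip (swap (flip (swap hq))),
          by simp [quadruplePair, Sym2.eq_swap (a := l), Sym2.eq_swap (a := j)]⟩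
      · exact ⟨swap hq, by simp [quadruplePair]⟩
      · exact ⟨swap (flip hq), by simp [quadruplePair, Sym2.eq_swap (a := j)]⟩
      · exact ⟨flip (swap hq), by simp [quadruplePair, Sym2.eq_swap (a := l)]⟩
      · exact ⟨flip (swap (flip hq)),
          by simp [quadruplePair, Sym2.eq_swap (a := l), Sym2.eq_swap (a := j)]⟩
    refine le_trans (le_of_eq ?_) (Finset.card_le_card hsub)
    simp [h1, h2, h3, h4, h5, h6, h1.symm, h2.symm, h3.symm, h4.symm, h5.symm, h6.symm]
  exact_mod_cast key

/-- Distinct edges at a common vertex point in independent directions, so they meet only at that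
vertex. The other coincidences of ends follow by reversing the edges. -/
lemma disjoint_ends_of_mem_openArc (hx : InGeneralPosition x) {a b : G.edgeSet} (hab : a ≠ b)
    {i j k l : V} (ha : a.1 = s(i, j)) (hb : b.1 = s(k, l)) {p : EuclideanSpace ℝ (Fin 2)}
    (hpa : p ∈ (straightLineDrawing G hx).openArc a)
    (hpb : p ∈ (straightLineDrawing G hx).openArc b) : i ≠ k := by
  rintro rfl
  have hij : i ≠ j := G.ne_of_adj (by simpa [ha] using a.2)
  have hil : i ≠ l := G.ne_of_adj (by simpa [hb] using b.2)
  have hjl : j ≠ l := by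
    rintro rfl
    exact hab (Subtype.ext (ha.trans hb.symm))
  obtain ⟨s, hs, h₁⟩ := mem_openArc_straightLineDrawing hx ha hpa
  obtain ⟨t, ht, h₂⟩ := mem_openArc_straightLineDrawing hx hb hpb
  have h := Complex.orthonormalBasisOneI.repr.injective (h₁.symm.trans h₂)
  exact hs.1.ne' (Subtype.ext (segPoint_common_endpoint (hx.2 i j l hij hil hjl) h))

/-- Sending a crossing to its pair of edges is injective, because two such segments meet at most
once. The pair has four distinct ends, so it comes from a meeting quadruple. -/
theorem eight_mul_crossings_le [Finite V] (G : SimpleGraph V) (hx : InGeneralPosition x) :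
    8 * (straightLineDrawing G hx).crossings ≤ (meetingQuadruples G x).encard := by
  refine le_trans ?_ (eight_mul_card_quadruplePair_le G x)
  gcongr
  rw [PlaneDrawing.crossings]
  refine Set.encard_le_encard_of_injOn (f := fun y => Sym2.map Subtype.val y.1) ?_ ?_
  · rintro ⟨-, p⟩ ⟨a, b, hab, rfl, hpa, hpb⟩
    obtain ⟨⟨i, j⟩, ha⟩ : ∃ q : V × V, a.1 = s(q.1, q.2) := ⟨Quot.out a.1, (Quot.out_eq a.1).symm⟩
    obtain ⟨⟨k, l⟩, hb⟩ : ∃ q : V × V, b.1 = s(q.1, q.2) := ⟨Quot.out b.1, (Quot.out_eq b.1).symm⟩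
    have ha' := ha.trans Sym2.eq_swap
    have hb' := hb.trans Sym2.eq_swap
    refine ⟨((i, j), (k, l)), ⟨?_, ?_, ?_, ?_, ?_, ?_, ?_⟩, ?_⟩
    · simpa [ha] using a.2
    · simpa [hb] using b.2
    · exact disjoint_ends_of_mem_openArc hx hab ha hb hpa hpb
    · exact disjoint_ends_of_mem_openArc hx hab ha hb' hpa hpb
    · exact disjoint_ends_of_mem_openArc hx hab ha' hb hpa hpb
    · exact disjoint_ends_of_mem_openArc hx hab ha' hb' hpa hpb
    · obtain ⟨s, hs, h₁⟩ := mem_openArc_straightLineDrawing hx ha hpa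
      obtain ⟨t, ht, h₂⟩ := mem_openArc_straightLineDrawing hx hb hpb
      exact ⟨s, t, Complex.orthonormalBasisOneI.repr.injective (h₁.symm.trans h₂)⟩
    · simp [quadruplePair, ha, hb]
  · rintro ⟨-, p⟩ ⟨a, b, hab, rfl, hpa, hpb⟩ ⟨z, p'⟩ ⟨a', b', hab', hz, hpa', hpb'⟩ h
    dsimp only at hz h
    have hz' := Sym2.map.injective Subtype.val_injective h
    subst hz'
    have hp' : p' ∈ (straightLineDrawing G hx).openArc a ∧
        p' ∈ (straightLineDrawing G hx).openArc b := by
      rcases Sym2.eq_iff.1 hz with ⟨rfl, rfl⟩ | ⟨rfl, rfl⟩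
      · exact ⟨hpa', hpb'⟩
      · exact ⟨hpb', hpa'⟩
    obtain ⟨⟨i, j⟩, ha⟩ : ∃ q : V × V, a.1 = s(q.1, q.2) := ⟨Quot.out a.1, (Quot.out_eq a.1).symm⟩
    obtain ⟨⟨k, l⟩, hb⟩ : ∃ q : V × V, b.1 = s(q.1, q.2) := ⟨Quot.out b.1, (Quot.out_eq b.1).symm⟩
    have hij : i ≠ j := G.ne_of_adj (by simpa [ha] using a.2)
    have hik := disjoint_ends_of_mem_openArc hx hab ha hb hpa hpb
    have hjk := disjoint_ends_of_mem_openArc hx hab (ha.trans Sym2.eq_swap) hb hpa hpb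
    obtain ⟨s, -, h₁⟩ := mem_openArc_straightLineDrawing hx ha hpa
    obtain ⟨t, -, h₂⟩ := mem_openArc_straightLineDrawing hx hb hpb
    obtain ⟨s', -, h₁'⟩ := mem_openArc_straightLineDrawing hx ha hp'.1
    obtain ⟨t', -, h₂'⟩ := mem_openArc_straightLineDrawing hx hb hp'.2
    have := segPoint_param_unique (hx.2 i j k hij hik hjk)
      (Complex.orthonormalBasisOneI.repr.injective (h₁.symm.trans h₂))
      (Complex.orthonormalBasisOneI.repr.injective (h₁'.symm.trans h₂'))
    refine Prod.ext rfl ?_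
    rw [h₁', ← this]
    exact h₁

end StraightLine

/-! ### The measure of the set of pairs of short segments that meet. -/

section Integral

open MeasureTheory

/-- For `F` homogeneous of degree 1, the Jacobian `r` makes the radial factor $\int_0^R r^2\,dr$. -/
lemma lintegral_closedBall_of_polar {F : ℂ → ℝ≥0∞} {h : ℝ → ℝ≥0∞} (hh : Measurable h) {R : ℝ}
    (hF : ∀ r θ, 0 < r → F (Complex.polarCoord.symm (r, θ)) = ENNReal.ofReal r * h θ) (hR : 0 ≤ R) :
    ∫⁻ v in Metric.closedBall (0 : ℂ) R, F v =
      ENNReal.ofReal (R ^ 3 / 3) * ∫⁻ θ in Set.Ioo (-Real.pi) Real.pi, h θ := by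
  have hrad : ∫⁻ r in Set.Ioc 0 R, ENNReal.ofReal (r ^ 2) = ENNReal.ofReal (R ^ 3 / 3) := by
    rw [← ofReal_integral_eq_lintegral_ofReal, ← intervalIntegral.integral_of_le hR, integral_pow]
    · norm_num
    · exact (continuous_pow 2).integrableOn_Ioc
    · exact Eventually.of_forall fun r => sq_nonneg r
  rw [← lintegral_indicator measurableSet_closedBall, ← Complex.lintegral_comp_polarCoord_symm,
    ← hrad, ← lintegral_indicator measurableSet_Ioc, ← lintegral_indicator measurableSet_Ioo,
    ← lintegral_prod_mul, ← Measure.volume_eq_prod, ← lintegral_indicator]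
  · congr 1
    ext ⟨r, θ⟩
    by_cases hr : 0 < r
    · by_cases hθ : θ ∈ Set.Ioo (-Real.pi) Real.pi
      · rw [Set.indicator_of_mem (by exact ⟨hr, hθ⟩)]
        simp only [smul_eq_mul, Set.indicator_of_mem hθ]
        by_cases hrR : r ≤ R
        · rw [Set.indicator_of_mem (by simp [abs_of_pos hr, hrR]),
            Set.indicator_of_mem (by exact ⟨hr, hrR⟩), hF r θ hr, ← mul_assoc,
            ← ENNReal.ofReal_mul hr.le, sq]
        · rw [Set.indicator_of_notMem (by simp [abs_of_pos hr]; linarith),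
            Set.indicator_of_notMem (by simp [hrR])]
          simp
      · rw [Set.indicator_of_notMem (by simp [polarCoord] at hθ ⊢; tauto),
          Set.indicator_of_notMem hθ, mul_zero]
    · rw [Set.indicator_of_notMem (by simp [polarCoord]; tauto),
        Set.indicator_of_notMem (by simp; tauto), zero_mul]
  · exact polarCoord.open_target.measurableSet
  · exact ((by fun_prop : Measurable fun r : ℝ => ENNReal.ofReal (r ^ 2)).indicator
      measurableSet_Ioc).aemeasurable
  · exact (hh.indicator measurableSet_Ioo).aemeasurable

lemma integral_abs_sin_sub (φ : ℝ) : ∫ θ in (-Real.pi)..Real.pi, |Real.sin (θ - φ)| = 4 := by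
  have hper : Function.Periodic (fun θ => |Real.sin θ|) (2 * Real.pi) := fun θ => by
    simp [Real.sin_add_two_pi]
  have hcont : Continuous fun θ => |Real.sin θ| := Real.continuous_sin.abs
  have h₀ : ∫ θ in (0 : ℝ)..Real.pi, |Real.sin θ| = 2 := by
    rw [show (2 : ℝ) = ∫ θ in (0 : ℝ)..Real.pi, Real.sin θ by rw [integral_sin]; norm_num]
    refine intervalIntegral.integral_congr fun θ hθ => ?_
    rw [Set.uIcc_of_le Real.pi_pos.le] at hθ
    exact abs_of_nonneg (Real.sin_nonneg_of_mem_Icc hθ)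
  have h₁ : ∫ θ in (-Real.pi)..0, |Real.sin θ| = 2 := by
    have := intervalIntegral.integral_comp_neg (a := -Real.pi) (b := 0) fun θ => |Real.sin θ|
    simp only [Real.sin_neg, abs_neg, neg_zero, neg_neg] at this
    rw [this, h₀]
  rw [intervalIntegral.integral_comp_sub_right (fun θ => |Real.sin θ|),
    show Real.pi - φ = (-Real.pi - φ) + 2 * Real.pi by ring, hper.intervalIntegral_add_eq _ (-Real.pi),
    show -Real.pi + 2 * Real.pi = Real.pi by ring,
    ← intervalIntegral.integral_add_adjacent_intervals (hcont.intervalIntegrable _ 0)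
      (hcont.intervalIntegrable _ _), h₀, h₁]
  norm_num

/-- In polar coordinates the integrand is $r\,\|v\|\,|\sin(\theta-\arg v)|$, and $|\sin|$ has
integral 4 over a full period. -/
lemma lintegral_planeCross_closedBall (v : ℂ) {R : ℝ} (hR : 0 ≤ R) :
    ∫⁻ w in Metric.closedBall (0 : ℂ) R, ENNReal.ofReal |planeCross v w| =
      ENNReal.ofReal (R ^ 3 / 3) * ENNReal.ofReal (‖v‖ * 4) := by
  have hmeas : Measurable fun θ : ℝ => ENNReal.ofReal (‖v‖ * |Real.sin (θ - Complex.arg v)|) := by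
    fun_prop
  rw [lintegral_closedBall_of_polar hmeas _ hR]
  · congr 1
    rw [← ofReal_integral_eq_lintegral_ofReal, ← integral_Ioc_eq_integral_Ioo,
      ← intervalIntegral.integral_of_le (by linarith [Real.pi_pos]),
      intervalIntegral.integral_const_mul, integral_abs_sin_sub]
    · exact (Continuous.integrableOn_Icc (by fun_prop)).mono_set Set.Ioo_subset_Icc_self
    · exact Eventually.of_forall fun θ => by positivity
  · intro r θ hr
    rw [← ENNReal.ofReal_mul hr.le]
    congr 1
    have h₁ : v.re = ‖v‖ * Real.cos v.arg := (Complex.norm_mul_cos_arg v).symm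
    have h₂ : v.im = ‖v‖ * Real.sin v.arg := (Complex.norm_mul_sin_arg v).symm
    have : planeCross v (Complex.polarCoord.symm (r, θ)) =
        r * (‖v‖ * Real.sin (θ - v.arg)) := by
      simp only [planeCross, Complex.polarCoord_symm_apply]
      rw [h₁, h₂, Real.sin_sub]
      simp [-Complex.norm_mul_cos_arg, -Complex.norm_mul_sin_arg, Complex.cos_ofReal_re, Complex.sin_ofReal_re]
      ring
    rw [this, abs_mul, abs_mul, abs_of_pos hr, abs_of_nonneg (norm_nonneg v)]

lemma lintegral_norm_closedBall {R c : ℝ} (hR : 0 ≤ R) (hc : 0 ≤ c) :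
    ∫⁻ v in Metric.closedBall (0 : ℂ) R, ENNReal.ofReal (‖v‖ * c) =
      ENNReal.ofReal (R ^ 3 / 3 * (2 * Real.pi * c)) := by
  rw [lintegral_closedBall_of_polar (h := fun _ => ENNReal.ofReal c) measurable_const _ hR]
  · rw [setLIntegral_const, Real.volume_Ioo, ← ENNReal.ofReal_mul hc,
      ← ENNReal.ofReal_mul (by positivity)]
    congr 1; ring
  · intro r θ hr
    rw [← ENNReal.ofReal_mul hr.le]
    simp [abs_of_pos hr]

lemma lintegral_planeCross_closedBall_closedBall {R : ℝ} (hR : 0 ≤ R) :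
    ∫⁻ v in Metric.closedBall (0 : ℂ) R, ENNReal.ofReal (R ^ 3 / 3) * ENNReal.ofReal (‖v‖ * 4) =
      ENNReal.ofReal (8 * Real.pi * R ^ 6 / 9) := by
  rw [lintegral_const_mul _ (by fun_prop), lintegral_norm_closedBall hR (by norm_num),
    ← ENNReal.ofReal_mul (by positivity)]
  congr 1; ring

/-- Meeting means $z-a=sv-tw$ with $s,t\in[0,1]$: the image of the unit square under a linear map of
determinant $-v\times w$. Dependent `v` and `w` need no separate case. -/
lemma volume_meetingSegments_translate_le (a v w : ℂ) :
    volume {z : ℂ | ((a, a + v), (z, z + w)) ∈ meetingSegments} ≤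
      ENNReal.ofReal |planeCross v w| := by
  let f : ℂ →ₗ[ℝ] ℂ := Complex.reLm.smulRight v - Complex.imLm.smulRight w
  have hdet : LinearMap.det f = - planeCross v w := by
    rw [← LinearMap.det_toMatrix Complex.basisOneI, Matrix.det_fin_two]
    simp [LinearMap.toMatrix_apply, f, planeCross]
    ring
  have hsub : {z : ℂ | ((a, a + v), (z, z + w)) ∈ meetingSegments} ⊆
      (fun z => a + z) '' (f '' (Set.Icc 0 1 ×ℂ Set.Icc 0 1)) := by
    rintro z ⟨s, t, h⟩
    refine ⟨z - a, ⟨⟨s, t⟩, ⟨s.2, t.2⟩, ?_⟩, by ring⟩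
    simp only [segPoint, add_sub_cancel_left] at h
    simp [f]
    linear_combination h
  have hsq : volume (Set.Icc (0 : ℝ) 1 ×ℂ Set.Icc (0 : ℝ) 1) = 1 := by
    have := Complex.volume_preserving_equiv_real_prod.measure_preimage
      (s := Set.Icc (0 : ℝ) 1 ×ˢ Set.Icc (0 : ℝ) 1)
      (measurableSet_Icc.prod measurableSet_Icc).nullMeasurableSet
    rw [Measure.volume_eq_prod, Measure.prod_prod] at this
    refine Eq.trans ?_ (this.trans (by simp))
    rfl
  refine (measure_mono hsub).trans ?_
  rw [Set.image_add_left, measure_preimage_add, Measure.addHaar_image_linearMap, hdet, hsq]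
  simp

/-- The shear $(z,w)\mapsto(z,z+w)$ preserves volume by translation invariance. It describes a
segment by its starting point and its direction. -/
lemma volume_eq_lintegral_shear {T : Set (ℂ × ℂ)} (hT : MeasurableSet T) :
    volume T = ∫⁻ w, volume {z | (z, z + w) ∈ T} := by
  have hT' : MeasurableSet {q : ℂ × ℂ | (q.1, q.1 + q.2) ∈ T} :=
    hT.preimage (by fun_prop)
  calc volume T = ∫⁻ z, volume (Prod.mk z ⁻¹' T) := by
        rw [Measure.volume_eq_prod, Measure.prod_apply hT]
    _ = ∫⁻ z, volume (Prod.mk z ⁻¹' {q : ℂ × ℂ | (q.1, q.1 + q.2) ∈ T}) := by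
        refine lintegral_congr fun z => ?_
        exact (measure_preimage_add volume z (Prod.mk z ⁻¹' T)).symm
    _ = volume {q : ℂ × ℂ | (q.1, q.1 + q.2) ∈ T} := by
        rw [Measure.volume_eq_prod, Measure.prod_apply hT']
    _ = _ := by
        rw [Measure.volume_eq_prod, Measure.prod_apply_symm hT']
        rfl

/-- The parameters `s`, `t` range over a compact square, and projection along a compact factor is
closed. This supplies measurability. -/
lemma isClosed_meetingSegments : IsClosed meetingSegments := by
  have : meetingSegments = Prod.fst ''
      {y : ((ℂ × ℂ) × (ℂ × ℂ)) × (unitInterval × unitInterval) |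
        segPoint y.1.1.1 y.1.1.2 y.2.1 = segPoint y.1.2.1 y.1.2.2 y.2.2} := by
    ext q
    simp [meetingSegments]
  rw [this]
  refine isClosedMap_fst_of_compactSpace _ (isClosed_eq ?_ ?_) <;>
  · unfold segPoint; fun_prop

/-- Pairs of segments of length at most `R` with a common point. -/
def shortMeetingSegments (R : ℝ) : Set ((ℂ × ℂ) × (ℂ × ℂ)) :=
  {q | q ∈ meetingSegments ∧ ‖q.1.2 - q.1.1‖ ≤ R ∧ ‖q.2.2 - q.2.1‖ ≤ R}

lemma measurableSet_shortMeetingSegments (R : ℝ) : MeasurableSet (shortMeetingSegments R) :=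
  (isClosed_meetingSegments.inter (IsClosed.inter
    (isClosed_le (f := fun q : (ℂ × ℂ) × (ℂ × ℂ) => ‖q.1.2 - q.1.1‖) (by fun_prop) continuous_const)
    (isClosed_le (f := fun q : (ℂ × ℂ) × (ℂ × ℂ) => ‖q.2.2 - q.2.1‖) (by fun_prop)
      continuous_const))).measurableSet

/-- Only one of the four ends is confined to `S`; the others range over the whole plane, so no
boundary terms appear in this upper bound. -/
theorem volume_shortMeetingSegments_le {R : ℝ} (hR : 0 ≤ R) {S : Set ℂ} (hS : MeasurableSet S) :
    volume (shortMeetingSegments R ∩ {q | q.1.1 ∈ S}) ≤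
      volume S * ENNReal.ofReal (8 * Real.pi * R ^ 6 / 9) := by
  have hmeas : MeasurableSet (shortMeetingSegments R ∩ {q | q.1.1 ∈ S}) :=
    (measurableSet_shortMeetingSegments R).inter (hS.preimage (by fun_prop))
  let g : ℂ → ℝ≥0∞ := (Metric.closedBall (0 : ℂ) R).indicator fun v =>
    ENNReal.ofReal (R ^ 3 / 3) * ENNReal.ofReal (‖v‖ * 4)
  have hg : Measurable g := Measurable.indicator (by fun_prop) measurableSet_closedBall
  rw [Measure.volume_eq_prod, Measure.prod_apply hmeas]
  calc _ ≤ ∫⁻ p : ℂ × ℂ, S.indicator 1 p.1 * g (p.2 - p.1) := by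
        refine lintegral_mono fun p => ?_
        by_cases hp : p.1 ∈ S; swap
        · simp [hp]
        by_cases hp' : p.2 - p.1 ∈ Metric.closedBall (0 : ℂ) R; swap
        · have : Prod.mk p ⁻¹' (shortMeetingSegments R ∩ {q | q.1.1 ∈ S}) = ∅ := by
            ext q
            simp only [Metric.mem_closedBall, dist_zero_right] at hp'
            simp [shortMeetingSegments, hp']
          simp [this]
        simp only [g, Set.indicator_of_mem hp, Set.indicator_of_mem hp', Pi.one_apply, one_mul]
        rw [volume_eq_lintegral_shear (hmeas.preimage measurable_prodMk_left),
          ← lintegral_planeCross_closedBall _ hR, ← lintegral_indicator measurableSet_closedBall]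
        refine lintegral_mono fun w => ?_
        by_cases hw : w ∈ Metric.closedBall (0 : ℂ) R
        · rw [Set.indicator_of_mem hw]
          refine le_trans (measure_mono ?_)
            (volume_meetingSegments_translate_le p.1 (p.2 - p.1) w)
          intro z hz
          simpa using hz.1.1
        · rw [Set.indicator_of_notMem hw, nonpos_iff_eq_zero]
          convert measure_empty (μ := (volume : Measure ℂ))
          ext z
          simp only [Metric.mem_closedBall, dist_zero_right] at hw
          simp [shortMeetingSegments, hw]
    _ = ∫⁻ x : ℂ, ∫⁻ y : ℂ, S.indicator 1 x * g (y - x) := by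
        rw [Measure.volume_eq_prod, lintegral_prod]
        exact (((measurable_one.indicator hS).comp measurable_fst).mul
          (hg.comp (by fun_prop))).aemeasurable
    _ = ∫⁻ x : ℂ, S.indicator 1 x * ENNReal.ofReal (8 * Real.pi * R ^ 6 / 9) := by
        refine lintegral_congr fun x => ?_
        rw [lintegral_const_mul (f := fun y => g (y - x)) _ (hg.comp (measurable_sub_const x)),
          lintegral_sub_right_eq_self g x,
          lintegral_indicator measurableSet_closedBall,
          lintegral_planeCross_closedBall_closedBall hR]
    _ = _ := by
        rw [lintegral_mul_const _ (measurable_one.indicator hS), lintegral_indicator_one hS]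

end Integral

/-! ### One random point in each cell, and the expected number of crossings. -/

section RandomPoints

open MeasureTheory ProbabilityTheory

variable {V : Type*} [Fintype V] {C : V → Set ℂ}

lemma isProbabilityMeasure_restrict_volume {s : Set ℂ} (h : volume s = 1) :
    IsProbabilityMeasure (volume.restrict s) := ⟨by simpa using h⟩

/-- The law of independent random points, one in each cell. -/
noncomputable def cellMeasure (C : V → Set ℂ) : Measure (V → ℂ) :=
  Measure.pi fun i => volume.restrict (C i)

lemma isProbabilityMeasure_cellMeasure (hvol : ∀ i, volume (C i) = 1) :
    IsProbabilityMeasure (cellMeasure C) := by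
  have := fun i => isProbabilityMeasure_restrict_volume (hvol i)
  unfold cellMeasure; infer_instance

lemma iIndepFun_eval_cellMeasure (hvol : ∀ i, volume (C i) = 1) :
    iIndepFun (fun i (x : V → ℂ) => x i) (cellMeasure C) := by
  have := fun i => isProbabilityMeasure_restrict_volume (hvol i)
  exact iIndepFun_pi (X := fun _ => id) fun _ => aemeasurable_id

lemma map_eval_cellMeasure (hvol : ∀ i, volume (C i) = 1) (i : V) :
    (cellMeasure C).map (fun x => x i) = volume.restrict (C i) := by
  have := fun i => isProbabilityMeasure_restrict_volume (hvol i)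
  exact (measurePreserving_eval (fun i => volume.restrict (C i)) i).map_eq

lemma aemeasurable_eval_cellMeasure (i : V) :
    AEMeasurable (fun x : V → ℂ => x i) (cellMeasure C) := (measurable_pi_apply i).aemeasurable

lemma map_pair_cellMeasure (hvol : ∀ i, volume (C i) = 1) {i j : V} (hij : i ≠ j) :
    (cellMeasure C).map (fun x => (x i, x j)) = volume.restrict (C i ×ˢ C j) := by
  have := isProbabilityMeasure_cellMeasure hvol
  rw [((iIndepFun_eval_cellMeasure hvol).indepFun hij).map_prod_eq_prod_map_map
    (aemeasurable_eval_cellMeasure i) (aemeasurable_eval_cellMeasure j), map_eval_cellMeasure hvol, map_eval_cellMeasure hvol,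
    Measure.prod_restrict, Measure.volume_eq_prod]

lemma map_triple_cellMeasure (hvol : ∀ i, volume (C i) = 1) {i j k : V} (hij : i ≠ j)
    (hik : i ≠ k) (hjk : j ≠ k) :
    (cellMeasure C).map (fun x => ((x i, x j), x k)) =
      volume.restrict ((C i ×ˢ C j) ×ˢ C k) := by
  have := isProbabilityMeasure_cellMeasure hvol
  rw [((iIndepFun_eval_cellMeasure hvol).indepFun_prodMk (fun i => measurable_pi_apply i)
    i j k hik hjk).map_prod_eq_prod_map_map
    (by fun_prop) (aemeasurable_eval_cellMeasure k), map_pair_cellMeasure hvol hij, map_eval_cellMeasure hvol,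
    Measure.prod_restrict]
  rfl

lemma map_quadruple_cellMeasure (hvol : ∀ i, volume (C i) = 1) {i j k l : V} (hij : i ≠ j)
    (hkl : k ≠ l) (hik : i ≠ k) (hil : i ≠ l) (hjk : j ≠ k) (hjl : j ≠ l) :
    (cellMeasure C).map (fun x => ((x i, x j), (x k, x l))) =
      volume.restrict ((C i ×ˢ C j) ×ˢ (C k ×ˢ C l)) := by
  have := isProbabilityMeasure_cellMeasure hvol
  rw [((iIndepFun_eval_cellMeasure hvol).indepFun_prodMk_prodMk (fun i => measurable_pi_apply i)
    i j k l hik hil hjk hjl).map_prod_eq_prod_map_map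
    (by fun_prop) (by fun_prop), map_pair_cellMeasure hvol hij, map_pair_cellMeasure hvol hkl,
    Measure.prod_restrict]
  rfl

lemma volume_diagonal_eq_zero : volume {p : ℂ × ℂ | p.1 = p.2} = 0 := by
  rw [Measure.volume_eq_prod,
    Measure.measure_prod_null (measurableSet_eq_fun measurable_fst measurable_snd)]
  refine Eventually.of_forall fun x => ?_
  have : Prod.mk x ⁻¹' {p : ℂ × ℂ | p.1 = p.2} = {x} := by
    ext y
    simp [eq_comm]
  exact (congrArg _ this).trans (measure_singleton x)

lemma volume_planeCross_eq_zero {u : ℂ} (hu : u ≠ 0) (a : ℂ) :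
    volume {z : ℂ | planeCross u (z - a) = 0} = 0 := by
  let f : ℂ →ₗ[ℝ] ℝ := u.re • Complex.imLm - u.im • Complex.reLm
  have hf : ∀ w, f w = planeCross u w := fun w => by simp [f, planeCross]
  have hker : LinearMap.ker f ≠ ⊤ := by
    intro h
    -- The rotated vector `I * u` has cross product $\|u\|^2$ with `u`, so the functional is nonzero
    -- and its kernel is a null set.
    have h' : f (Complex.I * u) = 0 := by
      rw [← LinearMap.mem_ker, h]; trivial
    rw [hf] at h'
    simp only [planeCross, Complex.mul_re, Complex.mul_im, Complex.I_re, Complex.I_im] at h'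
    apply hu
    apply Complex.ext <;> simp <;> nlinarith [sq_nonneg u.re, sq_nonneg u.im]
  have h := Measure.addHaar_submodule volume _ hker
  have h₂ := measure_preimage_add_right volume (-a) (LinearMap.ker f : Set ℂ)
  rw [h] at h₂
  convert h₂ using 2
  ext z
  simp [hf, sub_eq_add_neg]

lemma volume_collinear_eq_zero :
    volume {p : (ℂ × ℂ) × ℂ | planeCross (p.1.2 - p.1.1) (p.2 - p.1.1) = 0} = 0 := by
  have hmeas : MeasurableSet
      {p : (ℂ × ℂ) × ℂ | planeCross (p.1.2 - p.1.1) (p.2 - p.1.1) = 0} := by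
    refine measurableSet_eq_fun ?_ measurable_const
    unfold planeCross
    fun_prop
  rw [Measure.volume_eq_prod, Measure.measure_prod_null hmeas]
  have hdiag : ∀ᵐ p : ℂ × ℂ, p.1 ≠ p.2 := by
    rw [ae_iff]; simpa using volume_diagonal_eq_zero
  filter_upwards [hdiag] with p hp
  exact volume_planeCross_eq_zero (sub_ne_zero.2 hp.symm) p.1

/-- Pairs and triples of the points have laws that are restrictions of Lebesgue measure, for which
the diagonal and the collinear triples are null. -/
lemma ae_inGeneralPosition (hvol : ∀ i, volume (C i) = 1) :
    ∀ᵐ x ∂cellMeasure C, InGeneralPosition x := by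
  have h₁ : ∀ᵐ x ∂cellMeasure C, ∀ i j, i ≠ j → x i ≠ x j := by
    simp only [ae_all_iff, eventually_imp_distrib_left]
    intro i j hij
    have : ∀ᵐ p ∂(cellMeasure C).map (fun x => (x i, x j)), p.1 ≠ p.2 := by
      rw [map_pair_cellMeasure hvol hij]
      refine ae_restrict_of_ae ?_
      rw [ae_iff]; simpa using volume_diagonal_eq_zero
    exact ae_of_ae_map (f := fun x : V → ℂ => (x i, x j)) (by fun_prop) this
  have h₂ : ∀ᵐ x ∂cellMeasure C, ∀ i j k, i ≠ j → i ≠ k → j ≠ k →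
      planeCross (x j - x i) (x k - x i) ≠ 0 := by
    simp only [ae_all_iff, eventually_imp_distrib_left]
    intro i j k hij hik hjk
    have : ∀ᵐ p ∂(cellMeasure C).map (fun x => ((x i, x j), x k)),
        planeCross (p.1.2 - p.1.1) (p.2 - p.1.1) ≠ 0 := by
      rw [map_triple_cellMeasure hvol hij hik hjk]
      refine ae_restrict_of_ae ?_
      rw [ae_iff]; simpa using volume_collinear_eq_zero
    exact ae_of_ae_map (f := fun x : V → ℂ => ((x i, x j), x k)) (by fun_prop) this
  filter_upwards [h₁, h₂] with x hx₁ hx₂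
  exact ⟨fun i j h => by_contra fun hij => hx₁ i j hij h, hx₂⟩

/-- The number of meeting pairs of edges is on average at most the measure of the set of short
meeting segments. -/
lemma lintegral_meetingQuadruples_le (hvol : ∀ i, volume (C i) = 1)
    (hmeas : ∀ i, MeasurableSet (C i)) (hdisj : Pairwise (Function.onFun Disjoint C))
    (G : SimpleGraph V) {R : ℝ} (hR : 0 ≤ R)
    (hG : ∀ i j, G.Adj i j → ∀ x ∈ C i, ∀ y ∈ C j, ‖y - x‖ ≤ R) :
    ∃ f : (V → ℂ) → ℝ≥0∞, Measurable f ∧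
      (∀ x, ((meetingQuadruples G x).encard : ℝ≥0∞) ≤ f x) ∧
      ∫⁻ x, f x ∂cellMeasure C ≤
        Fintype.card V * ENNReal.ofReal (8 * Real.pi * R ^ 6 / 9) := by
  classical
  let Q : Finset ((V × V) × (V × V)) := Finset.univ.filter fun q =>
    G.Adj q.1.1 q.1.2 ∧ G.Adj q.2.1 q.2.2 ∧ q.1.1 ≠ q.2.1 ∧ q.1.1 ≠ q.2.2 ∧ q.1.2 ≠ q.2.1 ∧
      q.1.2 ≠ q.2.2
  let φ : (V × V) × (V × V) → (V → ℂ) → (ℂ × ℂ) × (ℂ × ℂ) := fun q x =>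
    ((x q.1.1, x q.1.2), (x q.2.1, x q.2.2))
  let box : (V × V) × (V × V) → Set ((ℂ × ℂ) × (ℂ × ℂ)) := fun q =>
    (C q.1.1 ×ˢ C q.1.2) ×ˢ (C q.2.1 ×ˢ C q.2.2)
  have hφ : ∀ q, Measurable (φ q) := fun q => by fun_prop
  have hM : MeasurableSet meetingSegments := isClosed_meetingSegments.measurableSet
  have hbox : ∀ q, MeasurableSet (box q) := fun q =>
    ((hmeas _).prod (hmeas _)).prod ((hmeas _).prod (hmeas _))
  refine ⟨fun x => ∑ q ∈ Q, (φ q ⁻¹' meetingSegments).indicator 1 x, ?_, ?_, ?_⟩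
  · exact Finset.measurable_fun_sum _ fun q _ => measurable_one.indicator (hφ q hM)
  · intro x
    have : meetingQuadruples G x = (Q.filter fun q => φ q x ∈ meetingSegments : Finset _) := by
      ext q
      simp [meetingQuadruples, Q, φ, and_assoc]
    rw [this, Set.encard_coe_eq_coe_finsetCard, Finset.card_filter]
    simp [Set.indicator_apply]
  · rw [lintegral_finsetSum _ fun q _ => measurable_one.indicator (hφ q hM)]
    -- Four distinct cells of area 1 give a point with density 1 on their product, so the
    -- probability of meeting is a volume.
    calc _ ≤ ∑ q ∈ Q, volume (shortMeetingSegments R ∩ box q) := by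
          refine Finset.sum_le_sum fun q hq => ?_
          obtain ⟨h1, h2, h3, h4, h5, h6⟩ := (Finset.mem_filter.1 hq).2
          rw [lintegral_indicator_one (hφ q hM), ← Measure.map_apply (hφ q) hM,
            map_quadruple_cellMeasure hvol h1.ne h2.ne h3 h4 h5 h6, Measure.restrict_apply hM]
          refine measure_mono fun y hy => ⟨⟨hy.1, ?_, ?_⟩, hy.2⟩
          · exact hG _ _ h1 _ hy.2.1.1 _ hy.2.1.2
          · exact hG _ _ h2 _ hy.2.2.1 _ hy.2.2.2
      -- Disjoint cells have disjoint products, so the probabilities add up to the volume of one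
      -- set.
      _ = volume (⋃ q ∈ Q, shortMeetingSegments R ∩ box q) := by
          rw [measure_biUnion_finset]
          · intro q _ q' _ hqq'
            refine Set.disjoint_left.2 fun y hy hy' => hqq' ?_
            have key : ∀ {i j : V} {z : ℂ}, z ∈ C i → z ∈ C j → i = j := fun {i j z} hi hj =>
              by_contra fun hij => Set.disjoint_left.1 (hdisj hij) hi hj
            exact Prod.ext (Prod.ext (key hy.2.1.1 hy'.2.1.1) (key hy.2.1.2 hy'.2.1.2))
              (Prod.ext (key hy.2.2.1 hy'.2.2.1) (key hy.2.2.2 hy'.2.2.2))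
          · exact fun q _ => (measurableSet_shortMeetingSegments R).inter (hbox q)
      _ ≤ volume (shortMeetingSegments R ∩ {q | q.1.1 ∈ ⋃ i, C i}) := by
          refine measure_mono (Set.iUnion₂_subset fun q _ y hy => ⟨hy.1, ?_⟩)
          exact Set.mem_iUnion.2 ⟨_, hy.2.1.1⟩
      _ ≤ volume (⋃ i, C i) * ENNReal.ofReal (8 * Real.pi * R ^ 6 / 9) :=
          volume_shortMeetingSegments_le hR (MeasurableSet.iUnion hmeas)
      _ = _ := by
          rw [measure_iUnion hdisj hmeas]
          simp [hvol]

theorem crossingNumber_le_of_cells (hvol : ∀ i, volume (C i) = 1)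
    (hmeas : ∀ i, MeasurableSet (C i)) (hdisj : Pairwise (Function.onFun Disjoint C))
    (G : SimpleGraph V) {R : ℝ} (hR : 0 ≤ R)
    (hG : ∀ i j, G.Adj i j → ∀ x ∈ C i, ∀ y ∈ C j, ‖y - x‖ ≤ R) :
    (crossingNumber G : ℝ≥0∞) ≤ ENNReal.ofReal (Fintype.card V * (Real.pi * R ^ 6 / 9)) := by
  have := isProbabilityMeasure_cellMeasure hvol
  obtain ⟨f, hf, hle, hint⟩ := lintegral_meetingQuadruples_le hvol hmeas hdisj G hR hG
  -- Some configuration outside the null set of degenerate ones does no worse than the mean.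
  obtain ⟨x, hx, hfx⟩ := exists_notMem_null_le_lintegral (μ := cellMeasure C) hf.aemeasurable
    (ae_iff.1 (ae_inGeneralPosition hvol))
  have hx : InGeneralPosition x := not_not.1 hx
  have h8 : 8 * ((straightLineDrawing G hx).crossings : ℝ≥0∞) ≤
      8 * ENNReal.ofReal (Fintype.card V * (Real.pi * R ^ 6 / 9)) := by
    calc _ = ((8 * (straightLineDrawing G hx).crossings : ℕ∞) : ℝ≥0∞) := by simp
      _ ≤ ((meetingQuadruples G x).encard : ℝ≥0∞) := by
          exact_mod_cast eight_mul_crossings_le G hx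
      _ ≤ _ := (hle x).trans (hfx.trans hint)
      _ = _ := by
          rw [← ENNReal.ofReal_natCast, ← ENNReal.ofReal_mul (by positivity),
            show (8 : ℝ≥0∞) = ENNReal.ofReal 8 by simp, ← ENNReal.ofReal_mul (by norm_num)]
          congr 1; ring
  refine le_trans ?_ ((ENNReal.mul_le_mul_iff_right (by norm_num) (by norm_num)).1 h8)
  exact_mod_cast iInf_le _ (straightLineDrawing G hx)

end RandomPoints

/-! ### The grid graph and its number of edges. -/

section Grid

open MeasureTheory

/-- The `k`-th unit cell of the integer grid, in rows of length `m`. -/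
def gridCell (m k : ℕ) : Set ℂ :=
  {z | ⌊z.re⌋ = ((k % m : ℕ) : ℤ) ∧ ⌊z.im⌋ = ((k / m : ℕ) : ℤ)}

lemma gridCell_eq (m k : ℕ) : gridCell m k =
    Complex.measurableEquivRealProd ⁻¹' (Set.Ico ((k % m : ℕ) : ℝ) ((k % m : ℕ) + 1) ×ˢ
      Set.Ico ((k / m : ℕ) : ℝ) ((k / m : ℕ) + 1)) := by
  ext z
  simp only [gridCell, Int.floor_eq_iff, Set.mem_ofPred_eq, Int.cast_natCast]
  rfl

lemma measurableSet_gridCell (m k : ℕ) : MeasurableSet (gridCell m k) := by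
  rw [gridCell_eq]
  exact Complex.measurableEquivRealProd.measurable (measurableSet_Ico.prod measurableSet_Ico)

lemma volume_preimage_rectangle (a b c d : ℝ) :
    volume (Complex.measurableEquivRealProd ⁻¹' (Set.Ico a b ×ˢ Set.Ico c d)) =
      ENNReal.ofReal (b - a) * ENNReal.ofReal (d - c) := by
  rw [Complex.volume_preserving_equiv_real_prod.measure_preimage
    (measurableSet_Ico.prod measurableSet_Ico).nullMeasurableSet, Measure.volume_eq_prod,
    Measure.prod_prod, Real.volume_Ico, Real.volume_Ico]

lemma volume_gridCell (m k : ℕ) : volume (gridCell m k) = 1 := by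
  rw [gridCell_eq, volume_preimage_rectangle]
  simp

lemma eq_of_mem_gridCell {m k l : ℕ} {z : ℂ} (hk : z ∈ gridCell m k) (hl : z ∈ gridCell m l) :
    k = l := by
  have h₁ : k % m = l % m := by exact_mod_cast hk.1.symm.trans hl.1
  have h₂ : k / m = l / m := by exact_mod_cast hk.2.symm.trans hl.2
  rw [← Nat.div_add_mod k m, ← Nat.div_add_mod l m, h₁, h₂]

lemma norm_sub_le_of_mem_gridCell {m k : ℕ} {x y : ℂ} (hx : x ∈ gridCell m k)
    (hy : y ∈ gridCell m k) : ‖y - x‖ ≤ 2 := by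
  have h₁ := Int.abs_sub_lt_one_of_floor_eq_floor (hy.1.trans hx.1.symm)
  have h₂ := Int.abs_sub_lt_one_of_floor_eq_floor (hy.2.trans hx.2.symm)
  have := Complex.norm_le_abs_re_add_abs_im (y - x)
  simp only [Complex.sub_re, Complex.sub_im] at this
  linarith

lemma exists_mem_gridCell {m : ℕ} {z : ℂ} (h₁ : 0 ≤ z.re) (h₂ : z.re < m) (h₃ : 0 ≤ z.im)
    (h₄ : z.im < m) : ∃ k < m * m, z ∈ gridCell m k := by
  have h₂' : ⌊z.re⌋₊ < m := (Nat.floor_lt h₁).2 h₂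
  have h₄' : ⌊z.im⌋₊ < m := (Nat.floor_lt h₃).2 h₄
  refine ⟨⌊z.re⌋₊ + m * ⌊z.im⌋₊, by nlinarith, ?_, ?_⟩
  · rw [Nat.add_mul_mod_self_left, Nat.mod_eq_of_lt h₂', Int.natCast_floor_eq_floor h₁]
  · rw [Nat.add_mul_div_left _ _ (by omega), Nat.div_eq_of_lt h₂', zero_add,
      Int.natCast_floor_eq_floor h₃]

/-- Vertices are adjacent if their grid cells contain points at distance less than `R`. -/
def gridGraph (n m : ℕ) (R : ℝ) : SimpleGraph (Fin n) where
  Adj i j := i ≠ j ∧ ∃ x ∈ gridCell m i, ∃ y ∈ gridCell m j, ‖y - x‖ < R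
  symm := ⟨fun i j ⟨hij, x, hx, y, hy, h⟩ => ⟨hij.symm, y, hy, x, hx, by rwa [norm_sub_rev]⟩⟩
  loopless := ⟨fun i h => h.1 rfl⟩

/-- Each end moves within its cell, by at most 2. This crude additive loss is harmless because `R`
tends to infinity. -/
lemma norm_sub_le_of_gridGraph_adj {n m : ℕ} {R : ℝ} {i j : Fin n} (h : (gridGraph n m R).Adj i j)
    {x y : ℂ} (hx : x ∈ gridCell m i) (hy : y ∈ gridCell m j) : ‖y - x‖ ≤ R + 4 := by
  obtain ⟨-, x', hx', y', hy', h⟩ := h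
  have h₁ := norm_sub_le_of_mem_gridCell hx hx'
  have h₂ := norm_sub_le_of_mem_gridCell hy' hy
  have h₃ := norm_add₃_le (a := y - y') (b := y' - x') (c := x' - x)
  rw [show y - y' + (y' - x') + (x' - x) = y - x by ring] at h₃
  linarith

/-- A point at distance at least `R` from the boundary of the square has its whole disc of radius
`R` inside the square. -/
lemma volume_near_pairs_ge {m : ℕ} {R : ℝ} (hR : 0 ≤ R) (hRm : 2 * R ≤ m) :
    ENNReal.ofReal ((m - 2 * R) ^ 2 * (Real.pi * R ^ 2)) ≤
      volume {p : ℂ × ℂ | (0 ≤ p.1.re ∧ p.1.re < m ∧ 0 ≤ p.1.im ∧ p.1.im < m) ∧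
        (0 ≤ p.2.re ∧ p.2.re < m ∧ 0 ≤ p.2.im ∧ p.2.im < m) ∧ ‖p.2 - p.1‖ < R} := by
  set I := Complex.measurableEquivRealProd ⁻¹' (Set.Ico R (m - R) ×ˢ Set.Ico R (m - R)) with hI
  have hImeas : MeasurableSet I :=
    Complex.measurableEquivRealProd.measurable (measurableSet_Ico.prod measurableSet_Ico)
  have hmeas : MeasurableSet {p : ℂ × ℂ | p.1 ∈ I ∧ ‖p.2 - p.1‖ < R} :=
    (hImeas.preimage measurable_fst).inter (measurableSet_lt
      (f := fun p : ℂ × ℂ => ‖p.2 - p.1‖) (by fun_prop) measurable_const)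
  calc _ = ∫⁻ x, I.indicator (fun _ => ENNReal.ofReal (Real.pi * R ^ 2)) x := by
        rw [lintegral_indicator_const hImeas, hI, volume_preimage_rectangle,
          ← ENNReal.ofReal_mul (by linarith), ← ENNReal.ofReal_mul (by positivity)]
        congr 1; ring
    _ ≤ volume {p : ℂ × ℂ | p.1 ∈ I ∧ ‖p.2 - p.1‖ < R} := by
        rw [Measure.volume_eq_prod, Measure.prod_apply hmeas]
        refine lintegral_mono fun x => ?_
        by_cases hx : x ∈ I
        · rw [Set.indicator_of_mem hx]
          have : Prod.mk x ⁻¹' {p : ℂ × ℂ | p.1 ∈ I ∧ ‖p.2 - p.1‖ < R} = Metric.ball x R := by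
            ext y; simp [hx, dist_eq_norm]
          rw [this, Complex.volume_ball, ← ENNReal.ofReal_pow hR,
            ← ENNReal.ofReal_coe_nnreal, ← ENNReal.ofReal_mul (by positivity), mul_comm]
          rfl
        · simp [hx]
    _ ≤ _ := by
        refine measure_mono ?_
        rintro ⟨x, y⟩ ⟨⟨⟨h₁, h₂⟩, h₃, h₄⟩, h⟩
        change R ≤ x.re at h₁
        change x.re < m - R at h₂
        change R ≤ x.im at h₃
        change x.im < m - R at h₄
        have h₅ := abs_le.1 (Complex.abs_re_le_norm (y - x))
        have h₆ := abs_le.1 (Complex.abs_im_le_norm (y - x))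
        simp only [Complex.sub_re, Complex.sub_im] at h₅ h₆
        refine ⟨⟨?_, ?_, ?_, ?_⟩, ⟨?_, ?_, ?_, ?_⟩, h⟩ <;> dsimp only at * <;> linarith

/-- Products of two unit cells cover the set of near pairs of points, so there are at least as many
near ordered pairs of cells as its volume. At most `n` of these are diagonal, and each edge accounts
for two of the rest. Cells beyond the first `m * m` can only add edges. -/
lemma card_edges_gridGraph_ge {n m : ℕ} (hmn : m * m ≤ n) {R : ℝ} (hR : 0 ≤ R)
    (hRm : 2 * R ≤ m) :
    (m - 2 * R) ^ 2 * (Real.pi * R ^ 2) - n ≤ 2 * ((gridGraph n m R).edgeSet.ncard : ℝ) := by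
  classical
  let G := gridGraph n m R
  let P : Finset (Fin n × Fin n) := Finset.univ.filter fun q =>
    ∃ x ∈ gridCell m q.1, ∃ y ∈ gridCell m q.2, ‖y - x‖ < R
  have hvol : ENNReal.ofReal ((m - 2 * R) ^ 2 * (Real.pi * R ^ 2)) ≤ (P.card : ℝ≥0∞) := by
    refine (volume_near_pairs_ge hR hRm).trans ?_
    calc _ ≤ volume (⋃ q ∈ P, gridCell m (q.1 : ℕ) ×ˢ gridCell m (q.2 : ℕ)) := by
          refine measure_mono ?_
          rintro ⟨x, y⟩ ⟨⟨h₁, h₂, h₃, h₄⟩, ⟨h₅, h₆, h₇, h₈⟩, h⟩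
          obtain ⟨k, hk, hxk⟩ := exists_mem_gridCell h₁ h₂ h₃ h₄
          obtain ⟨l, hl, hyl⟩ := exists_mem_gridCell h₅ h₆ h₇ h₈
          refine Set.mem_iUnion₂.2 ⟨(⟨k, hk.trans_le hmn⟩, ⟨l, hl.trans_le hmn⟩), ?_, hxk, hyl⟩
          simp only [P, Finset.mem_filter, Finset.mem_univ, true_and]
          exact ⟨x, hxk, y, hyl, h⟩
      _ ≤ ∑ q ∈ P, volume (gridCell m (q.1 : ℕ) ×ˢ gridCell m (q.2 : ℕ)) :=
          measure_biUnion_finset_le _ _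
      _ = _ := by
          simp [Measure.volume_eq_prod, Measure.prod_prod, volume_gridCell]
  have hcard : P.card ≤ 2 * G.edgeSet.ncard + n := by
    have hsub : P ⊆ (Finset.univ : Finset G.Dart).image (fun d => d.toProd) ∪
        (Finset.univ : Finset (Fin n)).image fun i => (i, i) := by
      rintro ⟨i, j⟩ hq
      simp only [P, Finset.mem_filter, Finset.mem_univ, true_and] at hq
      rw [Finset.mem_union]
      by_cases hij : i = j
      · right; simp [hij]
      · left; exact Finset.mem_image.2 ⟨⟨(i, j), hij, hq⟩, Finset.mem_univ _, rfl⟩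
    have h₁ : (Finset.univ : Finset G.Dart).card = 2 * G.edgeSet.ncard := by
      rw [Finset.card_univ, G.dart_card_eq_twice_card_edges, ← SimpleGraph.coe_edgeFinset,
        Set.ncard_coe_finset]
    calc P.card ≤ _ := Finset.card_le_card hsub
      _ ≤ _ := Finset.card_union_le _ _
      _ ≤ _ := Nat.add_le_add Finset.card_image_le Finset.card_image_le
      _ = _ := by rw [h₁, Finset.card_univ, Fintype.card_fin]
  have h : (m - 2 * R) ^ 2 * (Real.pi * R ^ 2) ≤ P.card := by
    rw [← ENNReal.ofReal_natCast] at hvol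
    exact (ENNReal.ofReal_le_ofReal_iff (by positivity)).1 hvol
  have hcard' : (P.card : ℝ) ≤ 2 * G.edgeSet.ncard + n := by exact_mod_cast hcard
  linarith

/-- Surplus edges of the grid graph are deleted to reach exactly `e`; the length bound survives. -/
theorem minCrossingNumber_le {n m e : ℕ} (hmn : m * m ≤ n) {R : ℝ} (hR : 0 ≤ R)
    (hRm : 2 * R ≤ m) (he : 2 * (e : ℝ) ≤ (m - 2 * R) ^ 2 * (Real.pi * R ^ 2) - n) :
    (minCrossingNumber n e : ℝ≥0∞) ≤ ENNReal.ofReal (n * (Real.pi * (R + 4) ^ 6 / 9)) := by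
  have hcard : e ≤ (gridGraph n m R).edgeSet.ncard := by
    have := he.trans (card_edges_gridGraph_ge hmn hR hRm)
    exact_mod_cast (mul_le_mul_iff_right₀ two_pos).1 this
  obtain ⟨s, hs, hse⟩ := Set.exists_subset_card_eq hcard
  have hedge : (SimpleGraph.fromEdgeSet s).edgeSet = s := by
    rw [SimpleGraph.edgeSet_fromEdgeSet, sdiff_eq_left, Set.disjoint_left]
    exact fun a ha hd => (gridGraph n m R).not_isDiag_of_mem_edgeSet (hs ha) hd
  have hle : minCrossingNumber n e ≤ crossingNumber (SimpleGraph.fromEdgeSet s) :=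
    iInf₂_le _ (by rw [hedge, hse])
  have hadj : ∀ i j, (SimpleGraph.fromEdgeSet s).Adj i j → ∀ x ∈ gridCell m (i : ℕ),
      ∀ y ∈ gridCell m (j : ℕ), ‖y - x‖ ≤ R + 4 := by
    intro i j h x hx y hy
    refine norm_sub_le_of_gridGraph_adj (n := n) (i := i) (j := j) ?_ hx hy
    exact hs ((SimpleGraph.fromEdgeSet_adj s).1 h).1
  have hdisj : Pairwise (Function.onFun Disjoint fun i : Fin n => gridCell m (i : ℕ)) :=
    fun i j hij => Set.disjoint_left.2 fun z hi hj => hij (Fin.ext (eq_of_mem_gridCell hi hj))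
  have := crossingNumber_le_of_cells (fun i : Fin n => volume_gridCell m i)
    (fun i => measurableSet_gridCell m i) hdisj (SimpleGraph.fromEdgeSet s)
    (by linarith : 0 ≤ R + 4) hadj
  rw [Fintype.card_fin] at this
  exact le_trans (by exact_mod_cast hle) this

end Grid

/-! ### Asymptotics in the midrange regime. -/

section Midrange

lemma tendsto_fst_midrange : Tendsto (fun p : ℕ × ℕ => (p.1 : ℝ)) midrange atTop :=
  tendsto_natCast_atTop_atTop.comp (tendsto_comap.mono_left (inf_le_left.trans inf_le_left))

lemma tendsto_div_midrange : Tendsto (fun p : ℕ × ℕ => (p.2 : ℝ) / p.1) midrange atTop :=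
  tendsto_comap.mono_left (inf_le_left.trans inf_le_right)

lemma tendsto_div_sq_midrange :
    Tendsto (fun p : ℕ × ℕ => (p.2 : ℝ) / (p.1 : ℝ) ^ 2) midrange (𝓝 0) :=
  tendsto_comap.mono_left inf_le_right

/-- Without this a limit along `midrange` would carry no information. The witness $(k^2,k^3)$ has
$e/n=k$ and $e/n^2=1/k$. -/
lemma midrange_neBot : midrange.NeBot := by
  have h : Tendsto (fun k : ℕ => ((k ^ 2, k ^ 3) : ℕ × ℕ)) atTop midrange := by
    refine tendsto_inf.2 ⟨tendsto_inf.2 ⟨?_, ?_⟩, ?_⟩ <;> rw [tendsto_comap_iff]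
    · exact tendsto_pow_atTop two_ne_zero
    · refine tendsto_natCast_atTop_atTop.congr' ?_
      filter_upwards [eventually_gt_atTop 0] with k hk
      have : (k : ℝ) ≠ 0 := by positivity
      simp only [Function.comp]
      push_cast
      field_simp
    · refine (tendsto_inv_atTop_nhds_zero_nat (𝕜 := ℝ)).congr' ?_
      filter_upwards [eventually_gt_atTop 0] with k hk
      have : (k : ℝ) ≠ 0 := by positivity
      simp only [Function.comp]
      push_cast
      field_simp
  exact h.neBot

lemma tendsto_natSqrt_div_sqrt :
    Tendsto (fun n : ℕ => (n.sqrt : ℝ) / √n) atTop (𝓝 1) := by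
  have hs : Tendsto (fun n : ℕ => √(n : ℝ)) atTop atTop :=
    Real.tendsto_sqrt_atTop.comp tendsto_natCast_atTop_atTop
  have h₀ : Tendsto (fun n : ℕ => 1 - (√(n : ℝ))⁻¹) atTop (𝓝 1) := by
    simpa using tendsto_const_nhds.sub (tendsto_inv_atTop_zero.comp hs)
  refine tendsto_of_tendsto_of_tendsto_of_le_of_le' h₀ tendsto_const_nhds ?_ ?_
  · filter_upwards [eventually_gt_atTop 0] with n hn
    have hpos : 0 < √(n : ℝ) := Real.sqrt_pos.2 (by positivity)
    have : √(n : ℝ) < n.sqrt + 1 := Real.real_sqrt_lt_nat_sqrt_succ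
    rw [le_div_iff₀ hpos, sub_mul, inv_mul_cancel₀ hpos.ne']
    linarith
  · filter_upwards [eventually_gt_atTop 0] with n hn
    exact div_le_one_of_le₀ Real.nat_sqrt_le_real_sqrt (Real.sqrt_nonneg _)

lemma eventually_crossingRatio_le {η c : ℝ} (hη : 0 < η)
    (hc : 8 / (9 * Real.pi ^ 2) * (1 + η) ^ 6 < c) :
    ∀ᶠ p in midrange, crossingRatio p ≤ ENNReal.ofReal c := by
  have hpi := Real.pi_pos
  -- The radius solves $\pi R^2n/2=e$ up to the factor $1+\eta$, which pays for the edges lost at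
  -- the boundary and on the diagonal.
  let R : ℕ × ℕ → ℝ := fun p => (1 + η) * √(2 / Real.pi * ((p.2 : ℝ) / p.1))
  have hRtop : Tendsto R midrange atTop :=
    (Real.tendsto_sqrt_atTop.comp (tendsto_div_midrange.const_mul_atTop (by positivity))).const_mul_atTop
      (by positivity)
  have hRsq : ∀ p, R p ^ 2 = (1 + η) ^ 2 * (2 / Real.pi * ((p.2 : ℝ) / p.1)) := fun p => by
    simp only [R]; rw [mul_pow, Real.sq_sqrt (by positivity)]
  have hRdiv : Tendsto (fun p => R p / √(p.1 : ℝ)) midrange (𝓝 0) := by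
    have h : Tendsto (fun p : ℕ × ℕ => (1 + η) * √(2 / Real.pi * ((p.2 : ℝ) / (p.1 : ℝ) ^ 2)))
        midrange (𝓝 0) := by
      simpa using ((tendsto_div_sq_midrange.const_mul (2 / Real.pi)).sqrt).const_mul (1 + η)
    refine h.congr fun p => ?_
    simp only [R]
    rw [mul_div_assoc, ← Real.sqrt_div' _ (by positivity)]
    congr 2
    rw [sq, ← div_div]; ring
  have hfst : Tendsto (fun p : ℕ × ℕ => p.1) midrange atTop :=
    tendsto_natCast_atTop_iff.1 tendsto_fst_midrange
  have hm : Tendsto (fun p : ℕ × ℕ => (p.1.sqrt : ℝ) / √(p.1 : ℝ) - 2 * (R p / √(p.1 : ℝ)))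
      midrange (𝓝 1) := by
    simpa using (tendsto_natSqrt_div_sqrt.comp hfst).sub (hRdiv.const_mul 2)
  -- This is the lower bound for the number of edges divided by `e`; its limit $(1+\eta)^2$ exceeds
  -- 1.
  have hedges : Tendsto (fun p : ℕ × ℕ =>
      ((p.1.sqrt : ℝ) / √(p.1 : ℝ) - 2 * (R p / √(p.1 : ℝ))) ^ 2 * (1 + η) ^ 2 -
        ((p.2 : ℝ) / p.1)⁻¹ / 2) midrange (𝓝 ((1 + η) ^ 2)) := by
    simpa using ((hm.pow 2).mul_const ((1 + η) ^ 2)).sub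
      ((tendsto_inv_atTop_zero.comp tendsto_div_midrange).div_const 2)
  have hratio : Tendsto (fun p => 8 / (9 * Real.pi ^ 2) * (1 + η) ^ 6 * (1 + 4 * (R p)⁻¹) ^ 6)
      midrange (𝓝 (8 / (9 * Real.pi ^ 2) * (1 + η) ^ 6)) := by
    simpa using ((((tendsto_inv_atTop_zero.comp hRtop).const_mul 4).const_add 1).pow 6).const_mul
      (8 / (9 * Real.pi ^ 2) * (1 + η) ^ 6)
  filter_upwards [hratio.eventually_lt_const hc,
    hedges.eventually_const_lt (show 1 < (1 + η) ^ 2 by nlinarith),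
    hm.eventually_const_lt one_pos, hRtop.eventually_gt_atTop 0,
    tendsto_fst_midrange.eventually_gt_atTop 0, tendsto_div_midrange.eventually_gt_atTop 0]
    with p h₁ h₂ h₃ hR hn hen
  obtain ⟨n, e⟩ := p
  dsimp only at h₁ h₂ h₃ hn hen
  have he : (0 : ℝ) < e := (div_pos_iff_of_pos_right hn).1 hen
  have hs : 0 < √(n : ℝ) := Real.sqrt_pos.2 hn
  have hss : √(n : ℝ) ^ 2 = n := Real.sq_sqrt hn.le
  have hsq := hRsq (n, e)
  generalize R (n, e) = r at *
  dsimp only at hsq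
  have hcr : (minCrossingNumber n e : ℝ≥0∞) ≤
      ENNReal.ofReal (n * (Real.pi * (r + 4) ^ 6 / 9)) := by
    refine minCrossingNumber_le (m := n.sqrt) (Nat.sqrt_le n) hR.le ?_ ?_
    · have : 0 < ((n.sqrt : ℝ) - 2 * r) / √(n : ℝ) := by
        rw [sub_div, mul_div_assoc]; exact h₃
      have := (div_pos_iff_of_pos_right hs).1 this
      linarith
    · have h₄ : (2 * e : ℝ) * 1 ≤ 2 * e * ((((n.sqrt : ℝ) / √(n : ℝ) - 2 * (r / √(n : ℝ))) ^ 2 *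
          (1 + η) ^ 2 - ((e : ℝ) / n)⁻¹ / 2)) := by gcongr
      refine (le_of_eq (mul_one _).symm).trans (h₄.trans (le_of_eq ?_))
      rw [hsq, ← mul_div_assoc, ← sub_div, div_pow, hss]
      field_simp
  rw [crossingRatio]
  calc _ ≤ ENNReal.ofReal (n * (Real.pi * (r + 4) ^ 6 / 9)) * (n : ℝ≥0∞) ^ 2 / (e : ℝ≥0∞) ^ 3 := by
        gcongr
    _ = ENNReal.ofReal (n * (Real.pi * (r + 4) ^ 6 / 9) * n ^ 2 / e ^ 3) := by
        rw [ENNReal.ofReal_div_of_pos (by positivity), ENNReal.ofReal_mul (q := (n : ℝ) ^ 2) (by positivity),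
          ENNReal.ofReal_pow hn.le, ENNReal.ofReal_pow he.le, ENNReal.ofReal_natCast,
          ENNReal.ofReal_natCast]
    _ = ENNReal.ofReal (8 / (9 * Real.pi ^ 2) * (1 + η) ^ 6 * (1 + 4 * r⁻¹) ^ 6) := by
        congr 1
        -- Writing the sixth power through `r ^ 2` allows `hsq` to replace $r^6$ by $(1+\eta)^6\cdot
        -- 8e^3/(\pi n)^3$.
        have h₅ : (r + 4) ^ 6 = (r ^ 2) ^ 3 * (1 + 4 * r⁻¹) ^ 6 := by
          rw [← pow_mul, ← mul_pow]; congr 1; field_simp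
        rw [h₅, hsq]
        field_simp
        ring
    _ ≤ ENNReal.ofReal c := ENNReal.ofReal_le_ofReal h₁.le

end Midrange

theorem mainTheorem1 :
    (∀ ε : ℝ, 0 < ε →
      ∀ᶠ p in midrange, crossingRatio p ≤ ENNReal.ofReal (8 / (9 * Real.pi ^ 2) + ε)) ∧
    (∀ γ : ℝ≥0, IsMidrangeCrossingConstant γ → (γ : ℝ) ≤ 8 / (9 * Real.pi ^ 2)) := by
  have hbound : ∀ ε : ℝ, 0 < ε →
      ∀ᶠ p in midrange, crossingRatio p ≤ ENNReal.ofReal (8 / (9 * Real.pi ^ 2) + ε) := by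
    intro ε hε
    have hcont : Tendsto (fun η : ℝ => 8 / (9 * Real.pi ^ 2) * (1 + η) ^ 6) (𝓝[>] 0)
        (𝓝 (8 / (9 * Real.pi ^ 2))) := by
      refine tendsto_nhdsWithin_of_tendsto_nhds ?_
      have : Continuous fun η : ℝ => 8 / (9 * Real.pi ^ 2) * (1 + η) ^ 6 := by fun_prop
      simpa using this.tendsto 0
    obtain ⟨η, hη, hη0⟩ := ((hcont.eventually_lt_const
      (lt_add_of_pos_right _ hε)).and self_mem_nhdsWithin).exists
    exact eventually_crossingRatio_le hη0 hη
  refine ⟨hbound, fun γ hγ => le_of_forall_pos_le_add fun ε hε => ?_⟩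
  have := midrange_neBot
  have h := le_of_tendsto hγ (hbound ε hε)
  rw [← ENNReal.ofReal_coe_nnreal] at h
  exact (ENNReal.ofReal_le_ofReal_iff (by positivity)).1 h
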